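/- Let $\mu>-1/2$ and let $d\lambda_\mu(x)=|x|^{2\mu}e^{-x^2}\,dx$ on $\mathbb R$. Put $$\gamma_\mu(2m)=\frac{2^{2m}\,m!\,\Gamma(m+\mu+\frac12)}{\Gamma(\mu+\frac12)},\qquad \gamma_\mu(2m+1)=\frac{2^{2m+1}\,m!\,\Gamma(m+\mu+\frac32)}{\Gamma(\mu+\frac12)},\qquad e_\mu(z)=\sum_{m=0}^\infty\frac{z^m}{\gamma_\mu(m)},$$ and, for $0<r<1$ and $x,y\in\mathbb R$, $$K_r(x,y)=\frac{1}{\Gamma(\mu+\frac12)(1-r^2)^{\mu+\frac12}}\;e^{-(x^2+y^2)\frac{r^2}{1-r^2}}\;e_\mu\!\left(\frac{2xyr}{1-r^2}\right).$$ The generalized Ornstein–Uhlenbeck semigroup is $T_\mu^tf(x)=\int_{\mathbb R}K_{e^{-t}}(x,y)f(y)\,d\lambda_\mu(y)$, $t>0$, and its maximal function is $T_\mu^*f(x)=\sup_{t>0}|T_\mu^tf(x)|\in[0,\infty]$. For every (real- or complex-valued) $f\in L^1(\lambda_\mu)$ the integrals defining $T_\mu^tf(x)$ converge absolutely for all $t>0$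 and $x\in\mathbb R$, and $T_\mu^*f$ is measurable. Moreover: (i) $T_\mu^*$ is of weak type $(1,1)$ with respect to $\lambda_\mu$: there is a constant $C>0$, depending only on $\mu$, such that for every $f\in L^1(\lambda_\mu)$ and every $\eta>0$, $$\lambda_\mu\{x\in\mathbb R: T_\mu^*f(x)>\eta\}\le\frac{C}{\eta}\int_{\mathbb R}|f|\,d\lambda_\mu .$$ (ii) $T_\mu^*$ is bounded on $L^\infty$: there is a constant $C>0$, depending only on $\mu$, such that $\|T_\mu^*f\|_\infty\le C\|f\|_\infty$ for every $f\in L^\infty(\lambda_\mu)$. -/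

import Mathlib

open MeasureTheory
open scoped ENNReal

namespace GenOU

noncomputable section

/-- The measure `dλ_μ(x) = |x|^{2μ} e^{-x²} dx` on the real line. -/
def lam (μ : ℝ) : Measure ℝ :=
  volume.withDensity fun x => ENNReal.ofReal (|x| ^ (2 * μ) * Real.exp (-x ^ 2))

/-- The generalized factorial: `γ_μ(2m) = 2^{2m} m! Γ(m+μ+1/2) / Γ(μ+1/2)` and
`γ_μ(2m+1) = 2^{2m+1} m! Γ(m+μ+3/2) / Γ(μ+1/2)`; here `n / 2` is the integer quotient `m`. -/
def genFactorial (μ : ℝ) (n : ℕ) : ℝ :=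
  if Even n then
    2 ^ n * ((n / 2).factorial : ℝ) * Real.Gamma (((n / 2 : ℕ) : ℝ) + μ + 1 / 2)
      / Real.Gamma (μ + 1 / 2)
  else
    2 ^ n * ((n / 2).factorial : ℝ) * Real.Gamma (((n / 2 : ℕ) : ℝ) + μ + 3 / 2)
      / Real.Gamma (μ + 1 / 2)

/-- The generalized exponential `e_μ(z) = ∑ z^m / γ_μ(m)`. -/
def genExp (μ z : ℝ) : ℝ := ∑' m : ℕ, z ^ m / genFactorial μ m

/-- The (generalized Mehler) kernel `K_r(x, y)`, `0 < r < 1`, with respect to `λ_μ`. -/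
def kernel (μ r x y : ℝ) : ℝ :=
  1 / (Real.Gamma (μ + 1 / 2) * (1 - r ^ 2) ^ (μ + 1 / 2))
    * Real.exp (-(x ^ 2 + y ^ 2) * (r ^ 2 / (1 - r ^ 2)))
    * genExp μ (2 * x * y * r / (1 - r ^ 2))

/-- The generalized Ornstein–Uhlenbeck semigroup
`T_μ^t f(x) = ∫ K_{e^{-t}}(x, y) f(y) dλ_μ(y)`. -/
def semigroup {𝕜 : Type*} [RCLike 𝕜] (μ t : ℝ) (f : ℝ → 𝕜) (x : ℝ) : 𝕜 :=
  ∫ y, kernel μ (Real.exp (-t)) x y • f y ∂(lam μ)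

/-- The maximal function `T_μ^* f(x) = sup_{t > 0} |T_μ^t f(x)|`, with values in `[0, ∞]`. -/
def maximal {𝕜 : Type*} [RCLike 𝕜] (μ : ℝ) (f : ℝ → 𝕜) (x : ℝ) : ℝ≥0∞ :=
  ⨆ (t : ℝ) (_ : 0 < t), ‖semigroup μ t f x‖ₑ

end

end GenOU

/-! The kernel is dominated by Gaussians, and the maximal operator is then controlled by an
uncentred maximal function on the line. Write `s = 1 - r ^ 2`. Since `γ_μ(n)` is at least of order
`n! (1 + n) ^ μ`, `e_μ(z)` is at most of order `(1 + |z|) ^ (-μ) e ^ |z|`. Completing the square in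
two ways bounds `|K_r(x, y)|` by Gaussians of width `√s`, one centred at `|y| = r|x|`, the other at
`r|y| = |x|` (`exists_abs_kernel_le_gaussian`). Using the first for `|y| ≤ |x|` and a flattened form
of the second beyond gives a majorant `F |y|` that is unimodal around `|x|` and has bounded
`λ_μ`-mass, uniformly in `r` and `x` (`exists_unimodal_majorant`). Such an `F` is a superposition of
indicators of intervals containing `|x|`. Hence `T_μ^* f(x)` is at most a constant times the
supremum, over intervals containing `|x|`, of averages of `|f|` for the image of `λ_μ` under `abs`
(`exists_maximal_le`). On the line this maximal function is of weak type (1,1) for every finite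
measure, without doubling, because intervals can be thinned to overlap at most twice. The `L^∞`
bound is immediate. -/

namespace GenOU

/-! ### Elementary inequalities for powers and exponentials. -/

/-- Real powers of comparable numbers are comparable. -/
lemma rpow_le_of_comparable {p q L : ℝ} (hp : 0 < p) (hq : 0 < q) (hL : 1 ≤ L)
    (h₁ : p ≤ L * q) (h₂ : q ≤ L * p) (μ : ℝ) : p ^ μ ≤ L ^ |μ| * q ^ μ := by
  have hL0 : 0 < L := by linarith
  rcases le_total 0 μ with h | h
  · rw [abs_of_nonneg h, ← Real.mul_rpow hL0.le hq.le]
    exact Real.rpow_le_rpow hp.le h₁ h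
  · rw [abs_of_nonpos h, Real.rpow_neg hL0.le, ← div_eq_inv_mul, ← Real.div_rpow hq.le hL0.le]
    refine Real.rpow_le_rpow_of_nonpos (by positivity) ?_ h
    rw [div_le_iff₀ hL0]; linarith

/-- Powers of `1 + q` are dominated by exponentials. -/
lemma exists_one_add_rpow_le_exp (m : ℝ) (hm : 0 ≤ m) (c : ℝ) (hc : 0 < c) :
    ∃ C : ℝ, 0 < C ∧ ∀ q : ℝ, 0 ≤ q → (1 + q) ^ m ≤ C * Real.exp (c * q) := by
  -- Only `0 < δ` and `δ * m ≤ c` matter; the `+ 1` covers `m = 0`.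
  set δ := c / (m + 1) with hδ
  have hδ0 : 0 < δ := by positivity
  have hM : (1 : ℝ) ≤ max 1 δ⁻¹ := le_max_left _ _
  have hM' : δ⁻¹ ≤ max 1 δ⁻¹ := le_max_right _ _
  refine ⟨(max 1 δ⁻¹) ^ m, by positivity, fun q hq => ?_⟩
  have h1 : 1 + q ≤ max 1 δ⁻¹ * Real.exp (δ * q) := by
    have h2 := Real.add_one_le_exp (δ * q)
    have h3 : q ≤ max 1 δ⁻¹ * (δ * q) := by
      calc q = δ⁻¹ * (δ * q) := by field_simp
        _ ≤ _ := by gcongr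
    nlinarith
  calc (1 + q) ^ m ≤ (max 1 δ⁻¹ * Real.exp (δ * q)) ^ m := by gcongr
    _ = (max 1 δ⁻¹) ^ m * Real.exp (δ * q * m) := by
      rw [Real.mul_rpow (by positivity) (by positivity), ← Real.exp_mul]
    _ ≤ _ := by
      have : δ * (m + 1) = c := by rw [hδ]; field_simp
      refine mul_le_mul_of_nonneg_left (Real.exp_le_exp.mpr ?_) (by positivity)
      nlinarith [mul_nonneg hδ0.le hq]

/-! ### Growth of the generalized factorial. -/

lemma Gamma_add_nat_eq_prod {a : ℝ} (ha : 0 < a) (m : ℕ) :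
    Real.Gamma (m + a) = Real.Gamma a * ∏ j ∈ Finset.range m, (a + j) := by
  induction m with
  | zero => simp
  | succ m ih =>
    rw [Finset.prod_range_succ, ← mul_assoc, ← ih,
      show ((m + 1 : ℕ) : ℝ) + a = (m + a) + 1 by push_cast; ring,
      Real.Gamma_add_one (by positivity)]
    ring

lemma genFactorial_two_mul {μ : ℝ} (hμ : -1 / 2 < μ) (m : ℕ) :
    genFactorial μ (2 * m) =
      2 ^ (2 * m) * m.factorial * ∏ j ∈ Finset.range m, (μ + 1 / 2 + j) := by
  have ha : 0 < μ + 1 / 2 := by linarith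
  have hG := (Real.Gamma_pos_of_pos ha).ne'
  have h2 : 2 * m / 2 = m := by omega
  rw [genFactorial, if_pos (even_two_mul m), h2, add_assoc, Gamma_add_nat_eq_prod ha]
  rw [mul_left_comm, mul_div_cancel_left₀ _ hG]

lemma genFactorial_two_mul_add_one {μ : ℝ} (hμ : -1 / 2 < μ) (m : ℕ) :
    genFactorial μ (2 * m + 1) =
      2 ^ (2 * m + 1) * m.factorial * ∏ j ∈ Finset.range (m + 1), (μ + 1 / 2 + j) := by
  have ha : 0 < μ + 1 / 2 := by linarith
  have hG := (Real.Gamma_pos_of_pos ha).ne'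
  have h2 : (2 * m + 1) / 2 = m := by omega
  rw [genFactorial, if_neg (by simp), h2,
    show (m : ℝ) + μ + 3 / 2 = ((m + 1 : ℕ) : ℝ) + (μ + 1 / 2) by push_cast; ring,
    Gamma_add_nat_eq_prod ha]
  rw [mul_left_comm, mul_div_cancel_left₀ _ hG]

/-- This is `γ_0(2m)`: comparing `n!` with `γ_μ(n)` reduces to comparing the two products. -/
lemma factorial_two_mul_eq_prod (m : ℕ) :
    ((2 * m).factorial : ℝ) =
      2 ^ (2 * m) * m.factorial * ∏ j ∈ Finset.range m, (1 / 2 + (j : ℝ)) := by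
  induction m with
  | zero => simp
  | succ m ih =>
    rw [show 2 * (m + 1) = 2 * m + 1 + 1 by ring, Nat.factorial_succ, Nat.factorial_succ,
      Nat.factorial_succ, Finset.prod_range_succ]
    push_cast
    rw [ih]
    ring

lemma factorial_two_mul_add_one_eq_prod (m : ℕ) :
    ((2 * m + 1).factorial : ℝ) =
      2 ^ (2 * m + 1) * m.factorial * ∏ j ∈ Finset.range (m + 1), (1 / 2 + (j : ℝ)) := by
  rw [Nat.factorial_succ, Finset.prod_range_succ]
  push_cast
  rw [factorial_two_mul_eq_prod]
  ring

/-- Lower bound for a Pochhammer symbol relative to that of `1 / 2`. -/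
lemma exists_prod_le_prod {μ : ℝ} (hμ : -1 / 2 < μ) :
    ∃ D : ℝ, 0 < D ∧ ∀ k : ℕ, (∏ j ∈ Finset.range k, (1 / 2 + (j : ℝ))) * (1 + (k : ℝ)) ^ μ ≤
      D * ∏ j ∈ Finset.range k, (μ + 1 / 2 + j) := by
  have ha : 0 < μ + 1 / 2 := by linarith
  -- The ratio equals `n ^ μ ∏ (1/2 + j) / ∏ (μ + 1/2 + j)` over `j ≤ n`; being convergent, it is
  -- bounded.
  have hlim : Filter.Tendsto (fun n => Real.GammaSeq (μ + 1 / 2) n / Real.GammaSeq (1 / 2) n)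
      Filter.atTop (nhds (Real.Gamma (μ + 1 / 2) / Real.Gamma (1 / 2))) :=
    (Real.GammaSeq_tendsto_Gamma _).div (Real.GammaSeq_tendsto_Gamma _)
      (Real.Gamma_pos_of_pos (by norm_num)).ne'
  obtain ⟨B, hB⟩ := hlim.bddAbove_range
  have hB' : ∀ n, Real.GammaSeq (μ + 1 / 2) n / Real.GammaSeq (1 / 2) n ≤ max B 1 := fun n =>
    (hB (Set.mem_range_self n)).trans (le_max_left _ _)
  have hP : ∀ (b : ℝ), 0 < b → ∀ k : ℕ, 0 < ∏ j ∈ Finset.range k, (b + (j : ℝ)) := fun b hb k =>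
    Finset.prod_pos fun j _ => by positivity
  have h12 : (0 : ℝ) < 1 / 2 := by norm_num
  -- The three summands serve `k ≥ 2`, `k = 0` and `k = 1`. For `k = N + 1` with `N ≥ 1`, the 3
  -- comes from `1 + k ≤ 3 * N`.
  refine ⟨max B 1 * 3 ^ |μ| + 1 + (1 / 2) / (μ + 1 / 2) * 2 ^ μ, by positivity, fun k => ?_⟩
  rcases k with _ | _ | n
  · simp only [Finset.range_zero, Finset.prod_empty, Nat.cast_zero, add_zero, Real.one_rpow]
    have : 0 < max B 1 * 3 ^ |μ| := by positivity
    have : 0 < (1 / 2) / (μ + 1 / 2) * 2 ^ μ := by positivity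
    linarith
  · have h1 : 0 < max B 1 * 3 ^ |μ| := by positivity
    simp only [zero_add, Finset.range_one, Finset.prod_singleton, Nat.cast_zero, Nat.cast_one,
      add_zero]
    have h2 : 1 / 2 * (1 + 1 : ℝ) ^ μ = (1 / 2) / (μ + 1 / 2) * 2 ^ μ * (μ + 1 / 2) := by
      rw [mul_right_comm, div_mul_cancel₀ _ ha.ne']; norm_num
    rw [h2]
    gcongr
    linarith
  · set N := n + 1 with hN
    have hN0 : (0 : ℝ) < N := by positivity
    have hseq : ∀ b : ℝ, 0 < b → ∏ j ∈ Finset.range (N + 1), (b + (j : ℝ)) =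
        (N : ℝ) ^ b * N.factorial / Real.GammaSeq b N := by
      intro b hb
      have := hP b hb (N + 1)
      rw [Real.GammaSeq]
      field_simp
    have hG : ∀ b : ℝ, 0 < b → 0 < Real.GammaSeq b N := by
      intro b hb
      have := hP b hb (N + 1)
      rw [Real.GammaSeq]
      positivity
    have g1 := hG _ ha
    have g2 := hG _ h12
    have hc : (1 + ((N + 1 : ℕ) : ℝ)) ^ μ ≤ 3 ^ |μ| * (N : ℝ) ^ μ := by
      have : (1 : ℝ) ≤ N := by rw [hN]; push_cast; linarith [n.cast_nonneg (α := ℝ)]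
      apply rpow_le_of_comparable <;> push_cast <;> linarith
    have key : (∏ j ∈ Finset.range (N + 1), (1 / 2 + (j : ℝ))) * (N : ℝ) ^ μ ≤
        max B 1 * ∏ j ∈ Finset.range (N + 1), (μ + 1 / 2 + (j : ℝ)) := by
      rw [hseq _ ha, hseq _ h12, Real.rpow_add hN0]
      have := hB' N
      rw [div_le_iff₀ g2] at this
      have e1 : (N : ℝ) ^ (1 / 2 : ℝ) * N.factorial / Real.GammaSeq (1 / 2) N * (N : ℝ) ^ μ =
        (N : ℝ) ^ (1 / 2 : ℝ) * N.factorial * (N : ℝ) ^ μ *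
          (1 / Real.GammaSeq (1 / 2) N) := by ring
      have e2 : max B 1 * ((N : ℝ) ^ μ * (N : ℝ) ^ (1 / 2 : ℝ) * N.factorial /
          Real.GammaSeq (μ + 1 / 2) N) = (N : ℝ) ^ (1 / 2 : ℝ) * N.factorial * (N : ℝ) ^ μ *
          (max B 1 / Real.GammaSeq (μ + 1 / 2) N) := by ring
      rw [e1, e2]
      apply mul_le_mul_of_nonneg_left _ (by positivity)
      rw [div_le_div_iff₀ g2 g1]
      linarith
    have p1 := hP _ ha (N + 1)
    have p2 := hP _ h12 (N + 1)
    calc _ ≤ (∏ j ∈ Finset.range (N + 1), (1 / 2 + (j : ℝ))) * (3 ^ |μ| * (N : ℝ) ^ μ) := by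
          gcongr
      _ = 3 ^ |μ| * ((∏ j ∈ Finset.range (N + 1), (1 / 2 + (j : ℝ))) * (N : ℝ) ^ μ) := by ring
      _ ≤ 3 ^ |μ| * (max B 1 * ∏ j ∈ Finset.range (N + 1), (μ + 1 / 2 + (j : ℝ))) := by gcongr
      _ = (max B 1 * 3 ^ |μ|) * ∏ j ∈ Finset.range (N + 1), (μ + 1 / 2 + (j : ℝ)) := by ring
      _ ≤ _ := by
        have : 0 < (1 / 2) / (μ + 1 / 2) * 2 ^ μ := by positivity
        apply mul_le_mul_of_nonneg_right _ p1.le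
        linarith

lemma genFactorial_pos {μ : ℝ} (hμ : -1 / 2 < μ) (n : ℕ) : 0 < genFactorial μ n := by
  have ha : 0 < μ + 1 / 2 := by linarith
  rcases Nat.even_or_odd' n with ⟨m, rfl | rfl⟩
  · rw [genFactorial_two_mul hμ]
    have := Finset.prod_pos (s := Finset.range m) (f := fun j : ℕ => μ + 1 / 2 + (j : ℝ))
      fun j _ => by positivity
    positivity
  · rw [genFactorial_two_mul_add_one hμ]
    have := Finset.prod_pos (s := Finset.range (m + 1)) (f := fun j : ℕ => μ + 1 / 2 + (j : ℝ))
      fun j _ => by positivity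
    positivity

/-- The generalized factorial is at least of size `n! (1 + n) ^ μ`. -/
lemma exists_factorial_le_genFactorial {μ : ℝ} (hμ : -1 / 2 < μ) :
    ∃ D : ℝ, 0 < D ∧ ∀ n : ℕ, (n.factorial : ℝ) * (1 + (n : ℝ)) ^ μ ≤ D * genFactorial μ n := by
  obtain ⟨D, hD, h⟩ := exists_prod_le_prod hμ
  refine ⟨D * 2 ^ |μ|, by positivity, fun n => ?_⟩
  have main : ∀ (A p p' : ℝ) (k : ℕ), 0 ≤ A → 0 ≤ p → p * (1 + (k : ℝ)) ^ μ ≤ D * p' →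
      k ≤ n → n ≤ 2 * k → A * p * (1 + (n : ℝ)) ^ μ ≤ D * 2 ^ |μ| * (A * p') := by
    intro A p p' k hA hp hpp h₁ h₂
    have h₁' : (k : ℝ) ≤ n := by exact_mod_cast h₁
    have h₂' : (n : ℝ) ≤ 2 * k := by exact_mod_cast h₂
    have hc : (1 + (n : ℝ)) ^ μ ≤ 2 ^ |μ| * (1 + (k : ℝ)) ^ μ := by
      apply rpow_le_of_comparable (by positivity) (by positivity) <;> linarith
    calc A * p * (1 + (n : ℝ)) ^ μ ≤ A * p * (2 ^ |μ| * (1 + (k : ℝ)) ^ μ) := by gcongr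
      _ = A * 2 ^ |μ| * (p * (1 + (k : ℝ)) ^ μ) := by ring
      _ ≤ A * 2 ^ |μ| * (D * p') := by gcongr
      _ = _ := by ring
  rcases Nat.even_or_odd' n with ⟨m, rfl | rfl⟩
  · rw [genFactorial_two_mul hμ, factorial_two_mul_eq_prod]
    exact main _ _ _ m (by positivity) (Finset.prod_nonneg fun j _ => by positivity) (h m)
      (by omega) (by omega)
  · rw [genFactorial_two_mul_add_one hμ, factorial_two_mul_add_one_eq_prod]
    exact main _ _ _ (m + 1) (by positivity) (Finset.prod_nonneg fun j _ => by positivity)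
      (h (m + 1)) (by omega) (by omega)

/-! ### Growth of the generalized exponential. -/

lemma factorial_add_le (n k : ℕ) :
    ((n + k).factorial : ℝ) ≤ k.factorial * n.factorial * (1 + (n : ℝ)) ^ k := by
  induction k with
  | zero => simp
  | succ k ih =>
    rw [← add_assoc, Nat.factorial_succ, Nat.factorial_succ k]
    push_cast
    have h : (n : ℝ) + k + 1 ≤ (k + 1) * (1 + n) := by
      nlinarith [mul_nonneg (n.cast_nonneg (α := ℝ)) (k.cast_nonneg (α := ℝ))]
    calc ((n : ℝ) + k + 1) * (n + k).factorial
        ≤ ((k + 1) * (1 + n)) * (k.factorial * n.factorial * (1 + (n : ℝ)) ^ k) := by gcongr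
      _ = _ := by ring

/-- Applied to `t = (1 + z) / (1 + n)`: the real power is traded for integer ones, whose sums
against `z ^ n / n!` are explicit or bounded by exponentials. -/
lemma rpow_le_one_add_pow_add_inv {t μ : ℝ} (ht : 0 < t) (hμ : -1 ≤ μ) {k : ℕ} (hk : μ ≤ k) :
    t ^ μ ≤ 1 + t ^ k + t⁻¹ := by
  have h1 : 0 < t ^ k := by positivity
  have h2 : 0 < t⁻¹ := by positivity
  rcases le_total 1 t with h | h
  · have : t ^ μ ≤ t ^ (k : ℝ) := Real.rpow_le_rpow_of_exponent_le h hk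
    rw [Real.rpow_natCast] at this
    linarith
  · have : t ^ μ ≤ t ^ (-1 : ℝ) := Real.rpow_le_rpow_of_exponent_ge ht h hμ
    rw [Real.rpow_neg_one] at this
    linarith

lemma hasSum_pow_div_factorial (z : ℝ) :
    HasSum (fun n : ℕ => z ^ n / n.factorial) (Real.exp z) := by
  rw [Real.exp_eq_exp_ℝ]
  exact NormedSpace.expSeries_div_hasSum_exp z

lemma hasSum_one_add_mul_pow_div_factorial (z : ℝ) :
    HasSum (fun n : ℕ => (1 + (n : ℝ)) * (z ^ n / n.factorial)) ((1 + z) * Real.exp z) := by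
  have h : HasSum (fun n : ℕ => (n : ℝ) * (z ^ n / n.factorial)) (z * Real.exp z) := by
    rw [← hasSum_nat_add_iff' 1]
    simp only [Finset.range_one, Finset.sum_singleton, Nat.cast_zero, zero_mul, sub_zero]
    refine ((hasSum_pow_div_factorial z).mul_left z).congr_fun ?_
    intro n
    rw [Nat.factorial_succ]
    push_cast
    field_simp
    ring
  simpa only [add_mul, one_mul] using (hasSum_pow_div_factorial z).add h

/-- A termwise estimate for the series of the generalized exponential. -/
lemma exists_term_le {μ : ℝ} (hμ : -1 / 2 < μ) :
    ∃ D : ℝ, 0 < D ∧ ∃ k : ℕ, ∀ z : ℝ, 0 ≤ z → ∀ n : ℕ, z ^ n / genFactorial μ n ≤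
      D * (1 + z) ^ (-μ) * (z ^ n / n.factorial +
        2 ^ k * (z ^ n / n.factorial + k.factorial * (z ^ (n + k) / (n + k).factorial)) +
        (1 + z)⁻¹ * ((1 + (n : ℝ)) * (z ^ n / n.factorial))) := by
  obtain ⟨D, hD, h⟩ := exists_factorial_le_genFactorial hμ
  obtain ⟨k, hk⟩ := exists_nat_ge μ
  refine ⟨D, hD, k, fun z hz n => ?_⟩
  have hg := genFactorial_pos hμ n
  have hz1 : 0 < 1 + z := by linarith
  have hn1 : 0 < 1 + (n : ℝ) := by positivity
  have hf : (0 : ℝ) < n.factorial := by positivity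
  have hfk : (0 : ℝ) < (n + k).factorial := by positivity
  have h1 : z ^ n / genFactorial μ n ≤ D * (1 + (n : ℝ)) ^ (-μ) * (z ^ n / n.factorial) := by
    rw [Real.rpow_neg hn1.le, div_le_iff₀ hg]
    have h3 : 0 < (1 + (n : ℝ)) ^ μ := by positivity
    calc z ^ n = z ^ n * ((n.factorial : ℝ) * (1 + (n : ℝ)) ^ μ) *
          (((1 + (n : ℝ)) ^ μ)⁻¹ / n.factorial) := by field_simp
      _ ≤ z ^ n * (D * genFactorial μ n) * (((1 + (n : ℝ)) ^ μ)⁻¹ / n.factorial) := by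
        exact mul_le_mul_of_nonneg_right (mul_le_mul_of_nonneg_left (h n) (by positivity))
          (by positivity)
      _ = _ := by ring
  have h2 : (1 + (n : ℝ)) ^ (-μ) = (1 + z) ^ (-μ) * ((1 + z) / (1 + n)) ^ μ := by
    rw [Real.div_rpow hz1.le hn1.le, Real.rpow_neg hn1.le, Real.rpow_neg hz1.le]
    field_simp
  have h4 := rpow_le_one_add_pow_add_inv (t := (1 + z) / (1 + n)) (by positivity)
    (by linarith : -1 ≤ μ) hk
  -- Dividing by `(1 + n) ^ k` turns `1 / n!` into at most `k! / (n + k)!`, so `z ^ k` only shifts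
  -- the exponential series.
  have h5 : ((1 + z) / (1 + (n : ℝ))) ^ k * (z ^ n / n.factorial) ≤
      2 ^ k * (z ^ n / n.factorial + k.factorial * (z ^ (n + k) / (n + k).factorial)) := by
    have h6 : (1 + z) ^ k ≤ 2 ^ k * (1 + z ^ k) := by
      calc (1 + z) ^ k ≤ 2 ^ (k - 1) * (1 ^ k + z ^ k) := add_pow_le zero_le_one hz k
        _ ≤ 2 ^ k * (1 + z ^ k) := by
          rw [one_pow]; gcongr
          · norm_num
          · omega
    have h7 : 1 / (1 + (n : ℝ)) ^ k ≤ 1 := by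
      rw [div_le_one (by positivity)]
      exact one_le_pow₀ (by linarith [n.cast_nonneg (α := ℝ)])
    have h8 : 1 / (1 + (n : ℝ)) ^ k * (1 / n.factorial) ≤ k.factorial / (n + k).factorial := by
      rw [div_mul_div_comm, div_le_div_iff₀ (by positivity) hfk]
      linarith [factorial_add_le n k]
    rw [div_pow]
    calc (1 + z) ^ k / (1 + (n : ℝ)) ^ k * (z ^ n / n.factorial)
        = (1 + z) ^ k * (1 / (1 + (n : ℝ)) ^ k * (z ^ n / n.factorial)) := by ring
      _ ≤ 2 ^ k * (1 + z ^ k) * (1 / (1 + (n : ℝ)) ^ k * (z ^ n / n.factorial)) := by gcongr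
      _ = 2 ^ k * (1 / (1 + (n : ℝ)) ^ k * (z ^ n / n.factorial) +
            z ^ (n + k) * (1 / (1 + (n : ℝ)) ^ k * (1 / n.factorial))) := by ring
      _ ≤ 2 ^ k * (1 * (z ^ n / n.factorial) +
            z ^ (n + k) * (k.factorial / (n + k).factorial)) := by gcongr
      _ = _ := by ring
  have h9 : ((1 + z) / (1 + (n : ℝ)))⁻¹ * (z ^ n / n.factorial) =
      (1 + z)⁻¹ * ((1 + (n : ℝ)) * (z ^ n / n.factorial)) := by
    rw [inv_div]; ring
  calc _ ≤ _ := h1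
    _ = D * (1 + z) ^ (-μ) * (((1 + z) / (1 + n)) ^ μ * (z ^ n / n.factorial)) := by
      rw [h2]; ring
    _ ≤ D * (1 + z) ^ (-μ) * ((1 + ((1 + z) / (1 + (n : ℝ))) ^ k + ((1 + z) / (1 + (n : ℝ)))⁻¹)
          * (z ^ n / n.factorial)) := by gcongr
    _ ≤ _ := by
      rw [add_mul, add_mul, one_mul, h9]
      gcongr

lemma exists_summable_and_tsum_le {μ : ℝ} (hμ : -1 / 2 < μ) :
    ∃ A : ℝ, 0 < A ∧ ∀ z : ℝ, 0 ≤ z → Summable (fun n : ℕ => z ^ n / genFactorial μ n) ∧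
      ∑' n : ℕ, z ^ n / genFactorial μ n ≤ A * ((1 + z) ^ (-μ) * Real.exp z) := by
  obtain ⟨D, hD, k, h⟩ := exists_term_le hμ
  refine ⟨D * (1 + 2 ^ k * (1 + k.factorial) + 1), by positivity, fun z hz => ?_⟩
  have hz1 : 0 < 1 + z := by linarith
  have hE := hasSum_pow_div_factorial z
  have hs : Summable fun n : ℕ => z ^ (n + k) / ((n + k).factorial : ℝ) :=
    (summable_nat_add_iff (f := fun n : ℕ => z ^ n / (n.factorial : ℝ)) k).2 hE.summable
  have hle : ∑' n : ℕ, z ^ (n + k) / ((n + k).factorial : ℝ) ≤ Real.exp z := by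
    rw [← hE.tsum_eq, ← hE.summable.sum_add_tsum_nat_add k]
    have : 0 ≤ ∑ i ∈ Finset.range k, z ^ i / (i.factorial : ℝ) :=
      Finset.sum_nonneg fun i _ => by positivity
    linarith
  have hB := ((hE.add ((hE.add (hs.hasSum.mul_left (k.factorial : ℝ))).mul_left (2 ^ k))).add
    ((hasSum_one_add_mul_pow_div_factorial z).mul_left (1 + z)⁻¹)).mul_left
      (D * (1 + z) ^ (-μ))
  have hnn : ∀ n, 0 ≤ z ^ n / genFactorial μ n := fun n =>
    div_nonneg (by positivity) (genFactorial_pos hμ n).le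
  have hsum : Summable (fun n : ℕ => z ^ n / genFactorial μ n) :=
    Summable.of_nonneg_of_le hnn (h z hz) hB.summable
  refine ⟨hsum, (hasSum_le (h z hz) hsum.hasSum hB).trans ?_⟩
  rw [inv_mul_cancel_left₀ hz1.ne']
  calc _ ≤ D * (1 + z) ^ (-μ) * (Real.exp z + 2 ^ k * (Real.exp z + k.factorial * Real.exp z) +
        Real.exp z) := by gcongr
    _ = _ := by ring

/-- The generalized exponential grows at most like `(1 + |z|) ^ (-μ) * exp |z|`. -/
lemma exists_abs_genExp_le {μ : ℝ} (hμ : -1 / 2 < μ) :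
    ∃ A : ℝ, 0 < A ∧ ∀ z : ℝ, |genExp μ z| ≤ A * ((1 + |z|) ^ (-μ) * Real.exp |z|) := by
  obtain ⟨A, hA, h⟩ := exists_summable_and_tsum_le hμ
  refine ⟨A, hA, fun z => ?_⟩
  obtain ⟨h1, h2⟩ := h |z| (abs_nonneg z)
  have e : ∀ n : ℕ, ‖z ^ n / genFactorial μ n‖ = |z| ^ n / genFactorial μ n := fun n => by
    rw [Real.norm_eq_abs, abs_div, abs_pow, abs_of_pos (genFactorial_pos hμ n)]
  refine le_trans ?_ h2
  rw [genExp, ← Real.norm_eq_abs]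
  refine (norm_tsum_le_tsum_norm (by simpa only [e] using h1)).trans_eq ?_
  simp only [e]

lemma continuous_genExp {μ : ℝ} (hμ : -1 / 2 < μ) : Continuous (genExp μ) := by
  obtain ⟨A, hA, h⟩ := exists_summable_and_tsum_le hμ
  rw [continuous_iff_continuousAt]
  intro z₀
  have hR : 0 ≤ |z₀| + 1 := by positivity
  have hc : ContinuousOn (genExp μ) (Metric.ball 0 (|z₀| + 1)) := by
    refine continuousOn_tsum (fun n => by fun_prop) (h _ hR).1 fun n z hz => ?_
    rw [mem_ball_zero_iff, Real.norm_eq_abs] at hz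
    rw [Real.norm_eq_abs, abs_div, abs_pow, abs_of_pos (genFactorial_pos hμ n)]
    have := genFactorial_pos hμ n
    gcongr
  refine hc.continuousAt (Metric.isOpen_ball.mem_nhds ?_)
  rw [mem_ball_zero_iff, Real.norm_eq_abs]
  linarith

/-! ### Gaussian bounds for the kernel. -/

/-- With `Q = (p - q) ^ 2 / s`, the two bases are comparable up to the factor `3 * (1 + Q)`. The
resulting power of `1 + Q` costs `exp (Q / 2)`, half of the kernel's Gaussian decay. -/
lemma exists_rpow_add_mul_le (μ : ℝ) :
    ∃ C : ℝ, 0 < C ∧ ∀ s p q : ℝ, 0 < s → 0 ≤ p → 0 ≤ q →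
      (s + 2 * p * q) ^ (-μ) ≤ C * ((s + p ^ 2) ^ (-μ) * Real.exp ((p - q) ^ 2 / (2 * s))) := by
  obtain ⟨C, hC, h⟩ := exists_one_add_rpow_le_exp |μ| (abs_nonneg μ) (1 / 2) (by norm_num)
  refine ⟨3 ^ |μ| * C, by positivity, fun s p q hs hp hq => ?_⟩
  set Q := (p - q) ^ 2 / s with hQ
  have hQ0 : 0 ≤ Q := by positivity
  have hQs : Q * s = (p - q) ^ 2 := by rw [hQ]; field_simp
  have hpq : 0 ≤ p * q := mul_nonneg hp hq
  have hp2 : 0 ≤ p ^ 2 := sq_nonneg p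
  have h1 : (s + 2 * p * q) ^ (-μ) ≤ (3 * (1 + Q)) ^ |-μ| * (s + p ^ 2) ^ (-μ) := by
    apply rpow_le_of_comparable
    · positivity
    · positivity
    · linarith
    · nlinarith [mul_nonneg hQ0 hp2, sq_nonneg (2 * p - q)]
    · nlinarith [mul_nonneg hQ0 hpq]
  rw [abs_neg, Real.mul_rpow (by norm_num) (by positivity)] at h1
  calc _ ≤ _ := h1
    _ ≤ 3 ^ |μ| * (C * Real.exp (1 / 2 * Q)) * (s + p ^ 2) ^ (-μ) := by
      gcongr; exact h Q hQ0
    _ = _ := by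
      rw [show 1 / 2 * Q = (p - q) ^ 2 / (2 * s) by rw [hQ]; field_simp]
      ring

lemma exists_abs_kernel_le {μ : ℝ} (hμ : -1 / 2 < μ) :
    ∃ C : ℝ, 0 < C ∧ ∀ r x y : ℝ, 0 < r → r < 1 → |kernel μ r x y| ≤
      C * ((1 - r ^ 2) ^ (-1 / 2 : ℝ) * (1 - r ^ 2 + 2 * (r * |x| * |y|)) ^ (-μ) *
        Real.exp ((2 * (r * |x| * |y|) - (x ^ 2 + y ^ 2) * r ^ 2) / (1 - r ^ 2))) := by
  obtain ⟨A, hA, h⟩ := exists_abs_genExp_le hμ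
  have hG : 0 < Real.Gamma (μ + 1 / 2) := Real.Gamma_pos_of_pos (by linarith)
  refine ⟨A / Real.Gamma (μ + 1 / 2), by positivity, fun r x y hr0 hr1 => ?_⟩
  have hs : 0 < 1 - r ^ 2 := by nlinarith
  have hz : |2 * x * y * r / (1 - r ^ 2)| = 2 * (r * |x| * |y|) / (1 - r ^ 2) := by
    rw [abs_div, abs_of_pos hs, abs_mul, abs_mul, abs_mul, abs_of_pos hr0, abs_two]
    ring
  have h1 := h (2 * x * y * r / (1 - r ^ 2))
  rw [hz] at h1
  set s := 1 - r ^ 2 with hsdef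
  set w := r * |x| * |y| with hw
  have hw0 : 0 ≤ w := by positivity
  have hpow : (s ^ (μ + 1 / 2))⁻¹ * (1 + 2 * w / s) ^ (-μ) =
      s ^ (-1 / 2 : ℝ) * (s + 2 * w) ^ (-μ) := by
    rw [show 1 + 2 * w / s = (s + 2 * w) / s by field_simp,
      Real.div_rpow (by positivity) hs.le, ← Real.rpow_neg hs.le,
      show (-(μ + 1 / 2)) = -1 / 2 + -μ by ring, Real.rpow_add hs]
    have : 0 < s ^ (-μ) := by positivity
    field_simp
  rw [kernel, ← hsdef, abs_mul, abs_mul, abs_of_pos (by positivity : 0 < 1 /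
    (Real.Gamma (μ + 1 / 2) * s ^ (μ + 1 / 2))), Real.abs_exp]
  calc _ ≤ 1 / (Real.Gamma (μ + 1 / 2) * s ^ (μ + 1 / 2)) *
        Real.exp (-(x ^ 2 + y ^ 2) * (r ^ 2 / s)) *
        (A * ((1 + 2 * w / s) ^ (-μ) * Real.exp (2 * w / s))) := by gcongr
    _ = A / Real.Gamma (μ + 1 / 2) * ((s ^ (μ + 1 / 2))⁻¹ * (1 + 2 * w / s) ^ (-μ) *
        (Real.exp (-(x ^ 2 + y ^ 2) * (r ^ 2 / s)) * Real.exp (2 * w / s))) := by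
      field_simp
    _ = _ := by
      rw [hpow, ← Real.exp_add]
      congr 3
      ring

/-- Two Gaussian bounds for the kernel, centred at `r |y| = |x|` and at `|y| = r |x|`. -/
lemma exists_abs_kernel_le_gaussian {μ : ℝ} (hμ : -1 / 2 < μ) :
    ∃ C : ℝ, 0 < C ∧ ∀ r x y : ℝ, 0 < r → r < 1 →
      |kernel μ r x y| ≤ C * ((1 - r ^ 2) ^ (-1 / 2 : ℝ) * (1 - r ^ 2 + |x| ^ 2) ^ (-μ) *
        Real.exp (|x| ^ 2 - (|x| - r * |y|) ^ 2 / (2 * (1 - r ^ 2)))) ∧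
      |kernel μ r x y| ≤ C * ((1 - r ^ 2) ^ (-1 / 2 : ℝ) * (1 - r ^ 2 + (r * |x|) ^ 2) ^ (-μ) *
        Real.exp (|y| ^ 2 - (r * |x| - |y|) ^ 2 / (2 * (1 - r ^ 2)))) := by
  obtain ⟨C₁, hC₁, h₁⟩ := exists_abs_kernel_le hμ
  obtain ⟨C₂, hC₂, h₂⟩ := exists_rpow_add_mul_le μ
  refine ⟨C₁ * C₂, by positivity, fun r x y hr0 hr1 => ?_⟩
  have hs : 0 < 1 - r ^ 2 := by nlinarith
  have h := h₁ r x y hr0 hr1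
  rw [← sq_abs x, ← sq_abs y] at h
  set X := |x| with hX
  set Y := |y| with hY
  have hX0 : 0 ≤ X := abs_nonneg x
  have hY0 : 0 ≤ Y := abs_nonneg y
  -- The exponent is `e - (p - q) ^ 2 / s` both for `(p, q, e) = (X, r * Y, X ^ 2)` and for `(r * X,
  -- Y, Y ^ 2)`.
  have main : ∀ p q e : ℝ, 0 ≤ p → 0 ≤ q → p * q = r * X * Y →
      e - (p - q) ^ 2 / (1 - r ^ 2) =
        (2 * (r * X * Y) - (X ^ 2 + Y ^ 2) * r ^ 2) / (1 - r ^ 2) →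
      |kernel μ r x y| ≤ C₁ * C₂ * ((1 - r ^ 2) ^ (-1 / 2 : ℝ) * (1 - r ^ 2 + p ^ 2) ^ (-μ) *
        Real.exp (e - (p - q) ^ 2 / (2 * (1 - r ^ 2)))) := by
    intro p q e hp hq hpq he
    have h3 := h₂ (1 - r ^ 2) p q hs hp hq
    rw [mul_assoc, hpq] at h3
    calc _ ≤ _ := h
      _ ≤ C₁ * ((1 - r ^ 2) ^ (-1 / 2 : ℝ) * (C₂ * ((1 - r ^ 2 + p ^ 2) ^ (-μ) *
            Real.exp ((p - q) ^ 2 / (2 * (1 - r ^ 2))))) *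
          Real.exp ((2 * (r * X * Y) - (X ^ 2 + Y ^ 2) * r ^ 2) / (1 - r ^ 2))) := by gcongr
      _ = C₁ * C₂ * ((1 - r ^ 2) ^ (-1 / 2 : ℝ) * (1 - r ^ 2 + p ^ 2) ^ (-μ) *
          (Real.exp ((p - q) ^ 2 / (2 * (1 - r ^ 2))) *
          Real.exp (e - (p - q) ^ 2 / (1 - r ^ 2)))) := by rw [he]; ring
      _ = _ := by
        rw [← Real.exp_add]
        congr 3
        field_simp
        ring
  constructor
  · apply main X (r * Y) (X ^ 2) hX0 (by positivity) (by ring)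
    field_simp
    ring
  · apply main (r * X) Y (Y ^ 2) (by positivity) hY0 (by ring)
    field_simp
    ring

/-! ### Mass of Gaussians for the weight `|y| ^ (2 * μ)`. -/

lemma lintegral_comp_abs (h : ℝ → ℝ≥0∞) :
    ∫⁻ y : ℝ, h |y| = 2 * ∫⁻ y in Set.Ioi (0 : ℝ), h y := by
  have e₁ : ∫⁻ y in Set.Ioi (0 : ℝ), h |y| = ∫⁻ y in Set.Ioi (0 : ℝ), h y :=
    setLIntegral_congr_fun measurableSet_Ioi fun y (hy : 0 < y) => by rw [abs_of_pos hy]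
  have e₂ : ∫⁻ y in Set.Iio (0 : ℝ), h |y| = ∫⁻ y in Set.Ioi (0 : ℝ), h |y| := by
    have := (Measure.measurePreserving_neg (volume : Measure ℝ)).setLIntegral_comp_preimage_emb
      (MeasurableEquiv.neg ℝ).measurableEmbedding (fun y => h |y|) (Set.Ioi (0 : ℝ))
    simpa using this
  rw [← lintegral_add_compl _ (measurableSet_Ioi (a := (0 : ℝ))), Set.compl_Ioi,
    ← setLIntegral_congr (Iio_ae_eq_Iic (a := (0 : ℝ))), e₂, e₁, two_mul]

lemma lintegral_gaussian_eq {k : ℝ} (hk : 0 < k) (b : ℝ) :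
    ∫⁻ y : ℝ, ENNReal.ofReal (Real.exp (-k * (y - b) ^ 2)) =
      ENNReal.ofReal √(Real.pi / k) := by
  rw [lintegral_sub_right_eq_self (fun y => ENNReal.ofReal (Real.exp (-k * y ^ 2))),
    ← integral_gaussian, ofReal_integral_eq_lintegral_ofReal (integrable_exp_neg_mul_sq hk)
      (Filter.Eventually.of_forall fun y => (Real.exp_pos _).le)]

lemma setLIntegral_Ioc_rpow {p R : ℝ} (hp : -1 < p) (hR : 0 ≤ R) :
    ∫⁻ y in Set.Ioc 0 R, ENNReal.ofReal (y ^ p) = ENNReal.ofReal (R ^ (p + 1) / (p + 1)) := by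
  have hi : IntegrableOn (fun y : ℝ => y ^ p) (Set.Ioc 0 R) := by
    rw [← intervalIntegrable_iff_integrableOn_Ioc_of_le hR]
    exact intervalIntegral.intervalIntegrable_rpow' hp
  rw [← ofReal_integral_eq_lintegral_ofReal hi
      (ae_restrict_of_forall_mem measurableSet_Ioc fun y hy => Real.rpow_nonneg hy.1.le p),
    ← intervalIntegral.integral_of_le hR, integral_rpow (Or.inl hp),
    Real.zero_rpow (by linarith), sub_zero]

/-- A pointwise bound for a Gaussian of width `√s` centred at `b` against the weight
`y ^ (2 * μ)`. -/
lemma exists_weighted_gaussian_le (μ : ℝ) {c : ℝ} (hc : 0 < c) :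
    ∃ C : ℝ, 0 < C ∧ ∀ s b y : ℝ, 0 < s → 0 < y →
      (s + b ^ 2) ^ (-μ) * Real.exp (-c * (y - b) ^ 2 / s) * y ^ (2 * μ) ≤
        C * (Real.exp (-(c / (2 * s)) * (y - b) ^ 2) +
          (Set.Ioc 0 √s).indicator (fun y => s ^ (-μ) * y ^ (2 * μ)) y) := by
  obtain ⟨C, hC, h⟩ := exists_one_add_rpow_le_exp |μ| (abs_nonneg μ) (c / 2) (by positivity)
  refine ⟨3 ^ |μ| * C, by positivity, fun s b y hs hy => ?_⟩
  set Q := (y - b) ^ 2 / s with hQ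
  have hQ0 : 0 ≤ Q := by positivity
  have hQs : Q * s = (y - b) ^ 2 := by rw [hQ]; field_simp
  have hb : 0 ≤ b ^ 2 := sq_nonneg b
  have hexp : Real.exp (-c * (y - b) ^ 2 / s) =
      Real.exp (-(c / (2 * s)) * (y - b) ^ 2) * Real.exp (-(c / 2 * Q)) := by
    rw [← Real.exp_add, hQ]
    congr 1
    field_simp
    ring
  have hE : Real.exp (-(c / (2 * s)) * (y - b) ^ 2) ≤ 1 := by
    rw [Real.exp_le_one_iff, neg_mul]
    exact neg_nonpos.mpr (by positivity)
  have hL : (3 * (1 + Q)) ^ |-μ| * Real.exp (-(c / 2 * Q)) ≤ 3 ^ |μ| * C := by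
    rw [abs_neg, Real.mul_rpow (by norm_num) (by positivity), mul_assoc, Real.exp_neg]
    gcongr
    rw [← div_eq_mul_inv, div_le_iff₀ (Real.exp_pos _)]
    exact h Q hQ0
  -- Half of the Gaussian pays for replacing `s + b ^ 2` by `T`: `T = s` when `y ≤ √s`, and
  -- otherwise `T = y ^ 2`, which cancels the weight.
  have gen : ∀ T : ℝ, 0 < T → s + b ^ 2 ≤ 3 * (1 + Q) * T → T ≤ 3 * (1 + Q) * (s + b ^ 2) →
      (s + b ^ 2) ^ (-μ) * Real.exp (-c * (y - b) ^ 2 / s) * y ^ (2 * μ) ≤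
        3 ^ |μ| * C * (Real.exp (-(c / (2 * s)) * (y - b) ^ 2) * (T ^ (-μ) * y ^ (2 * μ))) := by
    intro T hT h₁ h₂
    have := rpow_le_of_comparable (by positivity) hT (by linarith) h₁ h₂ (-μ)
    rw [hexp]
    calc _ ≤ (3 * (1 + Q)) ^ |-μ| * T ^ (-μ) * (Real.exp (-(c / (2 * s)) * (y - b) ^ 2) *
          Real.exp (-(c / 2 * Q))) * y ^ (2 * μ) := by gcongr
      _ = (3 * (1 + Q)) ^ |-μ| * Real.exp (-(c / 2 * Q)) *
          (Real.exp (-(c / (2 * s)) * (y - b) ^ 2) * (T ^ (-μ) * y ^ (2 * μ))) := by ring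
      _ ≤ _ := by gcongr
  by_cases hys : y ≤ √s
  · have hy2 : y ^ 2 ≤ s := by
      calc y ^ 2 ≤ √s ^ 2 := by gcongr
        _ = s := Real.sq_sqrt hs.le
    rw [Set.indicator_of_mem (show y ∈ Set.Ioc 0 √s from ⟨hy, hys⟩)]
    refine (gen s hs ?_ ?_).trans ?_
    · nlinarith [sq_nonneg (2 * y - b)]
    · nlinarith [mul_nonneg hQ0 hs.le, mul_nonneg hQ0 hb]
    · gcongr
      have h0 : 0 ≤ s ^ (-μ) * y ^ (2 * μ) := by positivity
      nlinarith [Real.exp_pos (-(c / (2 * s)) * (y - b) ^ 2)]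
  · have hy2 : s ≤ y ^ 2 := by
      rw [← Real.sqrt_le_left hy.le]; exact (not_le.mp hys).le
    rw [Set.indicator_of_notMem (fun hm => hys hm.2), add_zero]
    refine (gen (y ^ 2) (by positivity) ?_ ?_).trans_eq ?_
    · nlinarith [sq_nonneg (2 * y - b), mul_le_mul_of_nonneg_left hy2 hQ0]
    · nlinarith [mul_nonneg hQ0 hb, sq_nonneg (y - 2 * b)]
    · have : (y ^ 2) ^ (-μ) * y ^ (2 * μ) = 1 := by
        rw [← Real.rpow_natCast, ← Real.rpow_mul hy.le, ← Real.rpow_add hy]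
        norm_num
      rw [this, mul_one]

/-- Gaussians of width `√s` centred at `b`, suitably normalized, have bounded mass with respect to
`|y| ^ (2 * μ)`. -/
lemma exists_lintegral_weighted_gaussian_le {μ : ℝ} (hμ : -1 / 2 < μ) {c : ℝ} (hc : 0 < c) :
    ∃ C : ℝ, 0 < C ∧ ∀ s b : ℝ, 0 < s →
      ∫⁻ y : ℝ, ENNReal.ofReal (s ^ (-1 / 2 : ℝ) * (s + b ^ 2) ^ (-μ) *
        Real.exp (-c * (|y| - b) ^ 2 / s) * |y| ^ (2 * μ)) ≤ ENNReal.ofReal C := by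
  obtain ⟨C, hC, h⟩ := exists_weighted_gaussian_le μ hc
  have hp : 0 < 2 * μ + 1 := by linarith
  refine ⟨2 * (C * (√(2 * Real.pi / c) + 1 / (2 * μ + 1))), by positivity, fun s b hs => ?_⟩
  rw [lintegral_comp_abs (fun y => ENNReal.ofReal (s ^ (-1 / 2 : ℝ) * (s + b ^ 2) ^ (-μ) *
        Real.exp (-c * (y - b) ^ 2 / s) * y ^ (2 * μ))), ENNReal.ofReal_mul zero_le_two,
    ENNReal.ofReal_ofNat]
  gcongr
  have hs' : (0 : ℝ) < s ^ (-1 / 2 : ℝ) := by positivity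
  have hss : s ^ (-1 / 2 : ℝ) * √s = 1 := by
    rw [Real.sqrt_eq_rpow, ← Real.rpow_add hs]; norm_num
  have hk : 0 < c / (2 * s) := by positivity
  calc _ ≤ ∫⁻ y in Set.Ioi (0 : ℝ), ENNReal.ofReal (C * s ^ (-1 / 2 : ℝ)) *
        (ENNReal.ofReal (Real.exp (-(c / (2 * s)) * (y - b) ^ 2)) +
        (Set.Ioc 0 √s).indicator
          (fun y => ENNReal.ofReal (s ^ (-μ)) * ENNReal.ofReal (y ^ (2 * μ))) y) := by
        refine setLIntegral_mono' measurableSet_Ioi fun y hy => ?_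
        have hy : 0 < y := hy
        have hi : (Set.Ioc 0 √s).indicator
            (fun y => ENNReal.ofReal (s ^ (-μ)) * ENNReal.ofReal (y ^ (2 * μ))) y =
            ENNReal.ofReal ((Set.Ioc 0 √s).indicator (fun y => s ^ (-μ) * y ^ (2 * μ)) y) := by
          by_cases hm : y ∈ Set.Ioc 0 √s
          · rw [Set.indicator_of_mem hm, Set.indicator_of_mem hm,
              ENNReal.ofReal_mul (by positivity)]
          · rw [Set.indicator_of_notMem hm, Set.indicator_of_notMem hm, ENNReal.ofReal_zero]
        rw [hi, ← ENNReal.ofReal_add (by positivity)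
          (Set.indicator_nonneg (fun z hz => by have := hz.1; positivity) y),
          ← ENNReal.ofReal_mul (by positivity)]
        apply ENNReal.ofReal_le_ofReal
        have := mul_le_mul_of_nonneg_left (h s b y hs hy) hs'.le
        calc _ = _ := by ring
          _ ≤ _ := this
          _ = _ := by ring
    _ ≤ ∫⁻ y : ℝ, ENNReal.ofReal (C * s ^ (-1 / 2 : ℝ)) *
        (ENNReal.ofReal (Real.exp (-(c / (2 * s)) * (y - b) ^ 2)) +
        (Set.Ioc 0 √s).indicator
          (fun y => ENNReal.ofReal (s ^ (-μ)) * ENNReal.ofReal (y ^ (2 * μ))) y) :=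
        setLIntegral_le_lintegral _ _
    _ = ENNReal.ofReal (C * s ^ (-1 / 2 : ℝ)) * (ENNReal.ofReal √(Real.pi / (c / (2 * s))) +
        ENNReal.ofReal (s ^ (-μ)) * ENNReal.ofReal (√s ^ (2 * μ + 1) / (2 * μ + 1))) := by
        rw [lintegral_const_mul' _ _ ENNReal.ofReal_ne_top, lintegral_add_left (by fun_prop),
          lintegral_gaussian_eq hk, lintegral_indicator measurableSet_Ioc,
          lintegral_const_mul' _ _ ENNReal.ofReal_ne_top,
          setLIntegral_Ioc_rpow (by linarith) (Real.sqrt_nonneg s)]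
    _ = ENNReal.ofReal (C * (s ^ (-1 / 2 : ℝ) * (√(Real.pi / (c / (2 * s))) +
        s ^ (-μ) * (√s ^ (2 * μ + 1) / (2 * μ + 1))))) := by
        rw [← ENNReal.ofReal_mul (by positivity), ← ENNReal.ofReal_add (by positivity)
          (by positivity), ← ENNReal.ofReal_mul (by positivity), mul_assoc]
    _ = _ := by
        have e₁ : √(Real.pi / (c / (2 * s))) = √(2 * Real.pi / c) * √s := by
          rw [← Real.sqrt_mul (by positivity)]
          congr 1
          field_simp
        have e₂ : s ^ (-μ) * √s ^ (2 * μ + 1) = √s := by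
          rw [Real.sqrt_eq_rpow, ← Real.rpow_mul hs.le, ← Real.rpow_add hs]
          congr 1
          ring
        rw [e₁, ← mul_div_assoc, e₂]
        congr 2
        calc _ = s ^ (-1 / 2 : ℝ) * √s * (√(2 * Real.pi / c) + 1 / (2 * μ + 1)) := by ring
          _ = _ := by rw [hss, one_mul]

lemma isFiniteMeasure_lam {μ : ℝ} (hμ : -1 / 2 < μ) : IsFiniteMeasure (lam μ) := by
  obtain ⟨C, -, hC⟩ := exists_lintegral_weighted_gaussian_le hμ one_pos
  apply isFiniteMeasure_withDensity
  -- For `c = 1`, `s = 1`, `b = 0` the weighted Gaussian is the density of `lam μ`.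
  refine ((lintegral_mono fun y => ?_).trans (hC 1 0 one_pos)).trans_lt ENNReal.ofReal_lt_top |>.ne
  apply le_of_eq
  congr 1
  simp [mul_comm]

lemma measurable_lam_density (μ : ℝ) :
    Measurable fun x : ℝ => ENNReal.ofReal (|x| ^ (2 * μ) * Real.exp (-x ^ 2)) := by
  fun_prop

/-! ### The unimodal majorant of the kernel. -/

/-- For `y ≥ x`, the Gaussian factor `exp (x ^ 2 - y ^ 2)` makes up for the displacement of the
maximum of the kernel from `x` to `x / r`. -/
lemma sq_sub_sq_sub_le {r x y : ℝ} (hr0 : 0 < r) (hr1 : r < 1) (hx : 0 ≤ x) (hxy : x ≤ y) :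
    x ^ 2 - y ^ 2 - (max (r * y - x) 0) ^ 2 / (2 * (1 - r ^ 2)) ≤
      -(1 / 16) * (y - x) ^ 2 / (1 - r ^ 2) := by
  set s := 1 - r ^ 2 with hs
  have hs0 : 0 < s := by nlinarith
  have e₁ : (max (r * y - x) 0) ^ 2 / (2 * s) = (1 / 2 * (max (r * y - x) 0) ^ 2) / s := by
    field_simp
  rw [e₁, sub_le_iff_le_add, ← add_div, le_div_iff₀ hs0]
  obtain ⟨u, hu, rfl⟩ : ∃ u, 0 ≤ u ∧ y = x + u := ⟨y - x, by linarith, by ring⟩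
  have hm : r * (x + u) - x ≤ max (r * (x + u) - x) 0 := le_max_left _ _
  have hm0 : 0 ≤ max (r * (x + u) - x) 0 := le_max_right _ _
  set m := max (r * (x + u) - x) 0
  have hxu : 0 ≤ x * u := mul_nonneg hx hu
  -- The claim is `u ^ 2 / 16 ≤ (2 * x * u + u ^ 2) * s + m ^ 2 / 2`. If `r ≤ 1 / 2` then `s ≥ 3 /
  -- 4` and the `u ^ 2 * s` term suffices; otherwise `u ≤ 2 * (x * s + m)`.
  rcases le_total r (1 / 2) with h | h
  · nlinarith [mul_nonneg hxu hs0.le, sq_nonneg u, sq_nonneg m, mul_nonneg (sq_nonneg u) hr0.le]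
  · have h1 : r * u ≤ x * (1 - r) + m := by linarith
    have h2 : u ≤ 2 * (x * s + m) := by
      have : x * (1 - r) ≤ x * s := by
        apply mul_le_mul_of_nonneg_left _ hx
        nlinarith
      nlinarith
    have h3 : u ^ 2 ≤ 4 * (x * s * u) + 4 * m ^ 2 := by
      nlinarith [sq_nonneg (u - 2 * m)]
    nlinarith [mul_nonneg hxu hs0.le, sq_nonneg u, sq_nonneg m, mul_nonneg (sq_nonneg u) hs0.le]

/-- The term `y ^ 2` keeps the exponent increasing past `r * x`, up to `x`: its derivative has the
sign of `(1 - 2r²)y + rx ≥ (1 - r)(1 + 2r)y ≥ 0`. -/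
lemma sq_sub_div_le_of_le {r x y z : ℝ} (hr0 : 0 < r) (hr1 : r < 1) (hy : 0 ≤ y) (hyz : y ≤ z)
    (hzx : z ≤ x) :
    y ^ 2 - (r * x - y) ^ 2 / (2 * (1 - r ^ 2)) ≤ z ^ 2 - (r * x - z) ^ 2 / (2 * (1 - r ^ 2)) := by
  have hs0 : 0 < 2 * (1 - r ^ 2) := by nlinarith
  have key : (r * x - z) ^ 2 - (r * x - y) ^ 2 ≤ (z ^ 2 - y ^ 2) * (2 * (1 - r ^ 2)) := by
    have : 0 ≤ (z - y) * ((z + y) * (2 * (1 - r ^ 2)) - (z + y) + 2 * r * x) := by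
      apply mul_nonneg (by linarith)
      have h1 : 0 ≤ r * (2 * x - (z + y)) := mul_nonneg hr0.le (by linarith)
      have h2 : 0 ≤ (z + y) * ((1 - r) * (1 + 2 * r)) :=
        mul_nonneg (by linarith) (mul_nonneg (by linarith) (by linarith))
      linarith
    linarith
  have := (div_le_iff₀ hs0).mpr key
  rw [sub_div] at this
  linarith

/-- The truncation flattens the Gaussian up to its centre `x / r`, so that it never increases. -/
lemma sq_max_div_le_of_le {r x y z : ℝ} (hr0 : 0 < r) (hr1 : r < 1) (hzy : z ≤ y) :
    x ^ 2 - (max (r * y - x) 0) ^ 2 / (2 * (1 - r ^ 2)) ≤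
      x ^ 2 - (max (r * z - x) 0) ^ 2 / (2 * (1 - r ^ 2)) := by
  have hs0 : 0 < 2 * (1 - r ^ 2) := by nlinarith
  have : max (r * z - x) 0 ≤ max (r * y - x) 0 :=
    max_le_max (by nlinarith) le_rfl
  have h0 : 0 ≤ max (r * z - x) 0 := le_max_right _ _
  gcongr

/-- The kernel has a majorant, as a function of `|y|`, that is unimodal around `|x|` and has
bounded mass. -/
lemma exists_unimodal_majorant {μ : ℝ} (hμ : -1 / 2 < μ) :
    ∃ C : ℝ, 0 < C ∧ ∀ r : ℝ, 0 < r → r < 1 → ∀ x : ℝ, ∃ F : ℝ → ℝ, Measurable F ∧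
      (∀ y, 0 ≤ F y) ∧ (∀ y, ∀ z ∈ Set.uIcc |x| y, F y ≤ F z) ∧
      (∀ y, |kernel μ r x y| ≤ F |y|) ∧
      ∫⁻ y, ENNReal.ofReal (F |y|) ∂(lam μ) ≤ ENNReal.ofReal C := by
  obtain ⟨A, hA, hK⟩ := exists_abs_kernel_le_gaussian hμ
  obtain ⟨C₁, hC₁, h₁⟩ := exists_lintegral_weighted_gaussian_le hμ (c := 1 / 2) (by norm_num)
  obtain ⟨C₂, hC₂, h₂⟩ := exists_lintegral_weighted_gaussian_le hμ (c := 1 / 16) (by norm_num)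
  refine ⟨A * (C₁ + C₂), by positivity, fun r hr0 hr1 x => ?_⟩
  have hs : 0 < 1 - r ^ 2 := by nlinarith
  have hX0 : 0 ≤ |x| := abs_nonneg x
  set X := |x| with hX
  set s := 1 - r ^ 2 with hsdef
  set P : ℝ → ℝ := fun y => s ^ (-1 / 2 : ℝ) * (s + (r * X) ^ 2) ^ (-μ) *
    Real.exp (y ^ 2 - (r * X - y) ^ 2 / (2 * s)) with hP
  set N : ℝ → ℝ := fun y => s ^ (-1 / 2 : ℝ) * (s + X ^ 2) ^ (-μ) *
    Real.exp (X ^ 2 - (max (r * y - X) 0) ^ 2 / (2 * s)) with hN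
  have hP0 : ∀ y, 0 ≤ P y := fun y => by positivity
  have hN0 : ∀ y, 0 ≤ N y := fun y => by positivity
  have hPm : Measurable P := by fun_prop
  have hNm : Measurable N := by fun_prop
  set F₁ := (Set.Icc 0 X).indicator P with hF₁
  set F₂ := (Set.Ici X).indicator N with hF₂
  have hF₁0 : ∀ y, 0 ≤ F₁ y := Set.indicator_nonneg fun y _ => hP0 y
  have hF₂0 : ∀ y, 0 ≤ F₂ y := Set.indicator_nonneg fun y _ => hN0 y
  have hF₁m : Measurable F₁ := hPm.indicator measurableSet_Icc
  have hF₂m : Measurable F₂ := hNm.indicator measurableSet_Ici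
  refine ⟨fun y => A * (F₁ y + F₂ y), by fun_prop, fun y => ?_, fun y z hz => ?_, fun y => ?_, ?_⟩
  · exact mul_nonneg hA.le (add_nonneg (hF₁0 y) (hF₂0 y))
  · refine mul_le_mul_of_nonneg_left (add_le_add ?_ ?_) hA.le
    · by_cases hy : y ∈ Set.Icc 0 X
      · rw [Set.uIcc_of_ge hy.2] at hz
        have hz' : z ∈ Set.Icc 0 X := ⟨hy.1.trans hz.1, hz.2⟩
        simp only [hF₁]
        rw [Set.indicator_of_mem hy, Set.indicator_of_mem hz']
        simp only [hP]
        gcongr _ * Real.exp ?_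
        exact sq_sub_div_le_of_le hr0 hr1 hy.1 hz.1 hz.2
      · rw [hF₁, Set.indicator_of_notMem hy]; exact hF₁0 z
    · by_cases hy : y ∈ Set.Ici X
      · rw [Set.uIcc_of_le hy] at hz
        have hz' : z ∈ Set.Ici X := hz.1
        simp only [hF₂]
        rw [Set.indicator_of_mem hy, Set.indicator_of_mem hz']
        simp only [hN]
        gcongr _ * Real.exp ?_
        exact sq_max_div_le_of_le hr0 hr1 hz.2
      · rw [hF₂, Set.indicator_of_notMem hy]; exact hF₂0 z
  · obtain ⟨k₁, k₂⟩ := hK r x y hr0 hr1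
    rcases le_total |y| X with hy | hy
    · have hm : |y| ∈ Set.Icc 0 X := ⟨abs_nonneg y, hy⟩
      refine k₂.trans (mul_le_mul_of_nonneg_left ?_ hA.le)
      have : F₁ |y| = P |y| := Set.indicator_of_mem hm _
      rw [this]
      exact le_add_of_nonneg_right (hF₂0 _)
    · have hm : |y| ∈ Set.Ici X := hy
      refine k₁.trans (mul_le_mul_of_nonneg_left ?_ hA.le)
      have : F₂ |y| = N |y| := Set.indicator_of_mem hm _
      rw [this]
      refine le_trans ?_ (le_add_of_nonneg_left (hF₁0 _))
      simp only [hN]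
      gcongr _ * Real.exp (_ - ?_ / _)
      rcases le_total (r * |y| - X) 0 with h | h
      · rw [max_eq_right h, zero_pow two_ne_zero]; positivity
      · rw [max_eq_left h]; nlinarith
  -- The factor `exp (-y ^ 2)` of `λ_μ` exactly cancels the growth of `P`; for `N`,
  -- `sq_sub_sq_sub_le` yields a Gaussian centred at `X`.
  · have e : ∀ y : ℝ, ENNReal.ofReal (|y| ^ (2 * μ) * Real.exp (-y ^ 2)) *
        ENNReal.ofReal (A * (F₁ |y| + F₂ |y|)) ≤ ENNReal.ofReal A *
        (ENNReal.ofReal (s ^ (-1 / 2 : ℝ) * (s + (r * X) ^ 2) ^ (-μ) *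
          Real.exp (-(1 / 2) * (|y| - r * X) ^ 2 / s) * |y| ^ (2 * μ)) +
        ENNReal.ofReal (s ^ (-1 / 2 : ℝ) * (s + X ^ 2) ^ (-μ) *
          Real.exp (-(1 / 16) * (|y| - X) ^ 2 / s) * |y| ^ (2 * μ))) := by
      intro y
      rw [← ENNReal.ofReal_add (by positivity) (by positivity), ← ENNReal.ofReal_mul hA.le,
        ← ENNReal.ofReal_mul (by positivity)]
      apply ENNReal.ofReal_le_ofReal
      have g₁ : |y| ^ (2 * μ) * Real.exp (-y ^ 2) * F₁ |y| ≤
          s ^ (-1 / 2 : ℝ) * (s + (r * X) ^ 2) ^ (-μ) *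
          Real.exp (-(1 / 2) * (|y| - r * X) ^ 2 / s) * |y| ^ (2 * μ) := by
        by_cases hm : |y| ∈ Set.Icc 0 X
        · have : F₁ |y| = P |y| := Set.indicator_of_mem hm _
          rw [this]
          refine le_of_eq ?_
          calc _ = s ^ (-1 / 2 : ℝ) * (s + (r * X) ^ 2) ^ (-μ) * (Real.exp (-y ^ 2) *
                Real.exp (|y| ^ 2 - (r * X - |y|) ^ 2 / (2 * s))) * |y| ^ (2 * μ) := by
                  simp only [hP]; ring
            _ = _ := by
              rw [← Real.exp_add, sq_abs y]
              congr 3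
              field_simp
              ring
        · have : F₁ |y| = 0 := Set.indicator_of_notMem hm _
          rw [this, mul_zero]; positivity
      have g₂ : |y| ^ (2 * μ) * Real.exp (-y ^ 2) * F₂ |y| ≤
          s ^ (-1 / 2 : ℝ) * (s + X ^ 2) ^ (-μ) *
          Real.exp (-(1 / 16) * (|y| - X) ^ 2 / s) * |y| ^ (2 * μ) := by
        by_cases hm : |y| ∈ Set.Ici X
        · have : F₂ |y| = N |y| := Set.indicator_of_mem hm _
          rw [this]
          calc _ = s ^ (-1 / 2 : ℝ) * (s + X ^ 2) ^ (-μ) * (Real.exp (-y ^ 2) *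
                Real.exp (X ^ 2 - (max (r * |y| - X) 0) ^ 2 / (2 * s))) * |y| ^ (2 * μ) := by
                  simp only [hN]; ring
            _ ≤ _ := by
              rw [← Real.exp_add]
              gcongr
              have := sq_sub_sq_sub_le hr0 hr1 hX0 hm
              rw [sq_abs y] at this
              linarith
        · have : F₂ |y| = 0 := Set.indicator_of_notMem hm _
          rw [this, mul_zero]; positivity
      calc _ = A * (|y| ^ (2 * μ) * Real.exp (-y ^ 2) * F₁ |y| +
            |y| ^ (2 * μ) * Real.exp (-y ^ 2) * F₂ |y|) := by ring
        _ ≤ _ := by gcongr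
    rw [lam, lintegral_withDensity_eq_lintegral_mul _ (measurable_lam_density μ) (by fun_prop)]
    refine (lintegral_mono e).trans ?_
    rw [lintegral_const_mul' _ _ ENNReal.ofReal_ne_top, lintegral_add_left (by fun_prop),
      ENNReal.ofReal_mul hA.le, ENNReal.ofReal_add hC₁.le hC₂.le]
    gcongr
    · exact h₁ s (r * X) hs
    · exact h₂ s X hs

/-! ### A covering lemma and the uncentred maximal function on the line. -/

/-- Among three order-connected sets with a common point, one is contained in the union of the
other two. -/
lemma exists_subset_union_of_ordConnected {A : Fin 3 → Set ℝ} (hA : ∀ i, (A i).OrdConnected)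
    {x : ℝ} (hx : ∀ i, x ∈ A i) : ∃ i, A i ⊆ ⋃ j ∈ ({i}ᶜ : Set (Fin 3)), A j := by
  have hR : ∀ i j, A i ∩ Set.Ici x ⊆ A j ∨ A j ∩ Set.Ici x ⊆ A i := by
    intro i j
    by_contra! h
    obtain ⟨y, hy, hy'⟩ := Set.not_subset.mp h.1
    obtain ⟨z, hz, hz'⟩ := Set.not_subset.mp h.2
    rcases le_total y z with hyz | hyz
    · exact hy' ((hA j).out (hx j) hz.1 ⟨hy.2, hyz⟩)
    · exact hz' ((hA i).out (hx i) hy.1 ⟨hz.2, hyz⟩)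
  have hL : ∀ i j, A i ∩ Set.Iic x ⊆ A j ∨ A j ∩ Set.Iic x ⊆ A i := by
    intro i j
    by_contra! h
    obtain ⟨y, hy, hy'⟩ := Set.not_subset.mp h.1
    obtain ⟨z, hz, hz'⟩ := Set.not_subset.mp h.2
    rcases le_total y z with hyz | hyz
    · exact hz' ((hA i).out hy.1 (hx i) ⟨hyz, hz.2⟩)
    · exact hy' ((hA j).out hz.1 (hx j) ⟨hyz, hy.2⟩)
  -- On each side of `x` the three sets are nested. Choosing one largest set per side leaves a set
  -- covered by the others.
  have main : ∀ i j k, j ≠ i → k ≠ i → A i ∩ Set.Ici x ⊆ A j → A i ∩ Set.Iic x ⊆ A k →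
      ∃ i, A i ⊆ ⋃ j ∈ ({i}ᶜ : Set (Fin 3)), A j := by
    intro i j k hji hki h₁ h₂
    refine ⟨i, fun y hy => ?_⟩
    rcases le_total x y with h | h
    · exact Set.mem_biUnion (x := j) hji (h₁ ⟨hy, h⟩)
    · exact Set.mem_biUnion (x := k) hki (h₂ ⟨hy, h⟩)
  rcases hR 0 1 with r | r <;> rcases hR 0 2 with r' | r' <;> rcases hR 1 2 with r'' | r'' <;>
  rcases hL 0 1 with l | l <;> rcases hL 0 2 with l' | l' <;> rcases hL 1 2 with l'' | l'' <;>
  first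
  | exact main 0 1 1 (by decide) (by decide) (by assumption) (by assumption)
  | exact main 0 1 2 (by decide) (by decide) (by assumption) (by assumption)
  | exact main 0 2 1 (by decide) (by decide) (by assumption) (by assumption)
  | exact main 0 2 2 (by decide) (by decide) (by assumption) (by assumption)
  | exact main 1 0 0 (by decide) (by decide) (by assumption) (by assumption)
  | exact main 1 0 2 (by decide) (by decide) (by assumption) (by assumption)
  | exact main 1 2 0 (by decide) (by decide) (by assumption) (by assumption)
  | exact main 1 2 2 (by decide) (by decide) (by assumption) (by assumption)
  | exact main 2 0 0 (by decide) (by decide) (by assumption) (by assumption)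
  | exact main 2 0 1 (by decide) (by decide) (by assumption) (by assumption)
  | exact main 2 1 0 (by decide) (by decide) (by assumption) (by assumption)

/-- A finite family of order-connected sets of reals has a subfamily with the same union in which
no point lies in more than two sets. -/
lemma exists_subfamily_card_le_two (t : Finset (Set ℝ)) (ht : ∀ I ∈ t, I.OrdConnected) :
    ∃ u ⊆ t, (⋃ I ∈ u, I) = ⋃ I ∈ t, I ∧
      ∀ x : ℝ, ∀ v ⊆ u, (∀ I ∈ v, x ∈ I) → v.card ≤ 2 := by
  classical
  have hne : ((t.powerset.filter fun u => (⋃ I ∈ u, I) = ⋃ I ∈ t, I)).Nonempty :=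
    ⟨t, by simp⟩
  -- In a subfamily of least cardinality with the same union, no set can be erased; three sets
  -- through one point would allow it.
  obtain ⟨u, hu, hmin⟩ := Finset.exists_min_image _ Finset.card hne
  rw [Finset.mem_filter, Finset.mem_powerset] at hu
  refine ⟨u, hu.1, hu.2, fun x v hv hx => ?_⟩
  by_contra! hcard
  obtain ⟨w, hw, hw3⟩ := Finset.exists_subset_card_eq (show 3 ≤ v.card from hcard)
  let e := (Finset.equivFinOfCardEq hw3).symm
  have hwu : ∀ i, (e i : Set ℝ) ∈ u := fun i => hv (hw (e i).2)
  obtain ⟨i, hi⟩ := exists_subset_union_of_ordConnected (A := fun i => (e i : Set ℝ))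
    (fun i => ht _ (hu.1 (hwu i))) (x := x) (fun i => hx _ (hw (e i).2))
  have hun : (⋃ I ∈ u.erase (e i : Set ℝ), I) = ⋃ I ∈ t, I := by
    rw [← hu.2]
    refine Set.Subset.antisymm
      (Set.biUnion_subset_biUnion_left fun I hI => Finset.mem_of_mem_erase hI) ?_
    refine Set.iUnion₂_subset fun I hI => ?_
    by_cases hIe : I = (e i : Set ℝ)
    · subst hIe
      refine hi.trans (Set.iUnion₂_subset fun j hj => ?_)
      refine Set.subset_biUnion_of_mem (u := fun I : Set ℝ => I) (x := (e j : Set ℝ)) ?_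
      refine Finset.mem_erase.2 ⟨fun h => hj ?_, hwu j⟩
      exact e.injective (Subtype.ext h)
    · exact Set.subset_biUnion_of_mem (u := fun I : Set ℝ => I)
        (Finset.mem_erase.2 ⟨hIe, hI⟩)
  have h1 := hmin (u.erase (e i : Set ℝ)) (Finset.mem_filter.2
    ⟨Finset.mem_powerset.2 ((Finset.erase_subset _ _).trans hu.1), hun⟩)
  have h2 := Finset.card_erase_lt_of_mem (hwu i)
  omega

lemma sum_measure_le_two_mul (ρ : Measure ℝ) (u : Finset (Set ℝ))
    (hm : ∀ I ∈ u, MeasurableSet I)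
    (h : ∀ x : ℝ, ∀ v ⊆ u, (∀ I ∈ v, x ∈ I) → v.card ≤ 2) :
    ∑ I ∈ u, ρ I ≤ 2 * ρ Set.univ := by
  classical
  calc ∑ I ∈ u, ρ I = ∑ I ∈ u, ∫⁻ x, I.indicator 1 x ∂ρ :=
        Finset.sum_congr rfl fun I hI => (lintegral_indicator_one (hm I hI)).symm
    _ = ∫⁻ x, ∑ I ∈ u, I.indicator 1 x ∂ρ :=
        (lintegral_finsetSum' _ fun I hI => (measurable_one.indicator (hm I hI)).aemeasurable).symm
    _ ≤ ∫⁻ _, 2 ∂ρ := by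
        refine lintegral_mono fun x => ?_
        have := h x (u.filter fun I => x ∈ I) (Finset.filter_subset _ _)
          fun I hI => (Finset.mem_filter.1 hI).2
        simp only [Set.indicator_apply, Pi.one_apply]
        rw [Finset.sum_ite, Finset.sum_const_zero, add_zero, Finset.sum_const, nsmul_eq_mul,
          mul_one]
        exact_mod_cast this
    _ = 2 * ρ Set.univ := by rw [lintegral_const]

/-- The weak type estimate for the uncentred maximal function of a measure `ρ` with respect to a
finite measure `ν` on the line. -/
lemma mul_measure_exists_ordConnected_le (ν ρ : Measure ℝ) [IsFiniteMeasure ν] (η : ℝ≥0∞)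
    (hη : η ≠ ∞) :
    η * ν {x | ∃ I : Set ℝ, I.OrdConnected ∧ x ∈ I ∧ η * ν I < ρ I} ≤ 2 * ρ Set.univ := by
  set 𝒱 : Set (Set ℝ) := {V | IsOpen V ∧ V.OrdConnected ∧ η * ν V < ρ V} with h𝒱
  have hcov : {x | ∃ I : Set ℝ, I.OrdConnected ∧ x ∈ I ∧ η * ν I < ρ I} ⊆ ⋃₀ 𝒱 := by
    rintro x ⟨I, hI, hxI, hlt⟩
    -- Outer regularity of `ν` gives an open `U`; its component at `x` is an open interval
    -- containing `I`.
    obtain ⟨U, hIU, hU, hUlt⟩ : ∃ U ⊇ I, IsOpen U ∧ η * ν U < ρ I := by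
      rcases eq_or_ne η 0 with rfl | h0
      · exact ⟨Set.univ, Set.subset_univ _, isOpen_univ, by simpa using hlt⟩
      · have : ν I < ρ I / η := by
          rw [ENNReal.lt_div_iff_mul_lt (Or.inl h0) (Or.inl hη), mul_comm]; exact hlt
        obtain ⟨U, hIU, hU, hlt'⟩ := Set.exists_isOpen_lt_of_lt I _ this
        refine ⟨U, hIU, hU, ?_⟩
        rwa [ENNReal.lt_div_iff_mul_lt (Or.inl h0) (Or.inl hη), mul_comm] at hlt'
    have hsub : I ⊆ connectedComponentIn U x :=
      hI.isPreconnected.subset_connectedComponentIn hxI hIU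
    refine ⟨connectedComponentIn U x, ⟨hU.connectedComponentIn,
      isPreconnected_connectedComponentIn.ordConnected, ?_⟩, hsub hxI⟩
    calc η * ν (connectedComponentIn U x) ≤ η * ν U := by
          gcongr; exact connectedComponentIn_subset U x
      _ < ρ I := hUlt
      _ ≤ _ := measure_mono hsub
  have hopen : IsOpen (⋃₀ 𝒱) := isOpen_sUnion fun V hV => hV.1
  refine (mul_le_mul_right (measure_mono hcov) η).trans ?_
  -- Inner regularity reduces to compact `K`, hence to finitely many intervals.
  rw [hopen.measure_eq_iSup_isCompact, ENNReal.mul_iSup]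
  refine iSup_le fun K => ?_
  rw [ENNReal.mul_iSup]
  refine iSup_le fun hKV => ?_
  rw [ENNReal.mul_iSup]
  refine iSup_le fun hK => ?_
  obtain ⟨T, hT, hTf, hKT⟩ := hK.elim_finite_subcover_image (b := 𝒱) (c := id) (fun V hV => hV.1)
    (by rwa [Set.sUnion_eq_biUnion] at hKV)
  obtain ⟨u, hut, hun, hu⟩ := exists_subfamily_card_le_two hTf.toFinset
    fun I hI => (hT (hTf.mem_toFinset.1 hI)).2.1
  have hu𝒱 : ∀ I ∈ u, I ∈ 𝒱 := fun I hI => hT (hTf.mem_toFinset.1 (hut hI))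
  calc η * ν K ≤ η * ∑ I ∈ u, ν I := by
        gcongr
        refine (measure_mono ?_).trans (measure_biUnion_finset_le u id)
        refine hKT.trans ?_
        simp only [id]
        rw [hun]
        simp
    _ = ∑ I ∈ u, η * ν I := Finset.mul_sum _ _ _
    _ ≤ ∑ I ∈ u, ρ I := Finset.sum_le_sum fun I hI => (hu𝒱 I hI).2.2.le
    _ ≤ 2 * ρ Set.univ := sum_measure_le_two_mul ρ u (fun I hI => (hu𝒱 I hI).1.measurableSet) hu

/-- If `ρ ≤ A ν` on all order-connected sets containing `x`, the same holds for integrals of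
functions that are unimodal around `x`. -/
lemma lintegral_le_mul_of_unimodal {ν ρ : Measure ℝ} {x : ℝ} {A : ℝ≥0∞} (hA : A ≠ ∞)
    (h : ∀ I : Set ℝ, I.OrdConnected → x ∈ I → ρ I ≤ A * ν I) {F : ℝ → ℝ} (hF : Measurable F)
    (hF0 : ∀ y, 0 ≤ F y) (hFx : ∀ y, ∀ z ∈ Set.uIcc x y, F y ≤ F z) :
    ∫⁻ y, ENNReal.ofReal (F y) ∂ρ ≤ A * ∫⁻ y, ENNReal.ofReal (F y) ∂ν := by
  -- Layer cake: each nonempty superlevel set of `F` is order-connected and contains `x`.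
  rw [lintegral_eq_lintegral_meas_lt ρ (Filter.Eventually.of_forall hF0) hF.aemeasurable,
    lintegral_eq_lintegral_meas_lt ν (Filter.Eventually.of_forall hF0) hF.aemeasurable,
    ← lintegral_const_mul' _ _ hA]
  refine lintegral_mono fun t => ?_
  rcases Set.eq_empty_or_nonempty {y | t < F y} with he | ⟨y₀, hy₀⟩
  · simp [he]
  · refine h _ ⟨fun y hy w hw z hz => ?_⟩ (lt_of_lt_of_le hy₀ (hFx y₀ x Set.left_mem_uIcc))
    rcases le_total x z with hxz | hxz
    · exact lt_of_lt_of_le hw (hFx w z (Set.Icc_subset_uIcc ⟨hxz, hz.2⟩))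
    · exact lt_of_lt_of_le hy (hFx y z (Set.Icc_subset_uIcc' ⟨hz.1, hxz⟩))

/-! ### Absolute convergence, continuity and measurability. -/

lemma continuous_kernel {μ : ℝ} (hμ : -1 / 2 < μ) (r : ℝ) :
    Continuous fun p : ℝ × ℝ => kernel μ r p.1 p.2 := by
  have := continuous_genExp hμ
  unfold kernel
  fun_prop

/-- The kernel is bounded in `y`, locally uniformly in `x`. -/
lemma exists_continuous_abs_kernel_le {μ : ℝ} (hμ : -1 / 2 < μ) {r : ℝ} (hr0 : 0 < r)
    (hr1 : r < 1) : ∃ B : ℝ → ℝ, Continuous B ∧ ∀ x y, |kernel μ r x y| ≤ B x := by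
  obtain ⟨C, hC, h⟩ := exists_abs_kernel_le_gaussian hμ
  have hs : 0 < 1 - r ^ 2 := by nlinarith
  refine ⟨fun x => C * ((1 - r ^ 2) ^ (-1 / 2 : ℝ) * (1 - r ^ 2 + |x| ^ 2) ^ (-μ) *
    Real.exp (|x| ^ 2)), ?_, fun x y => (h r x y hr0 hr1).1.trans ?_⟩
  · have : Continuous fun x : ℝ => (1 - r ^ 2 + |x| ^ 2) ^ (-μ) :=
      Continuous.rpow_const (by fun_prop) fun x => Or.inl (by positivity)
    fun_prop
  · refine mul_le_mul_of_nonneg_left (mul_le_mul_of_nonneg_left (Real.exp_le_exp.mpr ?_)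
      (by positivity)) hC.le
    rw [sub_le_self_iff]
    positivity

section

variable {𝕜 : Type*} [RCLike 𝕜]

lemma integrable_kernel_smul {μ : ℝ} (hμ : -1 / 2 < μ) {r : ℝ} (hr0 : 0 < r) (hr1 : r < 1)
    {f : ℝ → 𝕜} (hf : Integrable f (lam μ)) (x : ℝ) :
    Integrable (fun y => kernel μ r x y • f y) (lam μ) := by
  obtain ⟨B, -, hB⟩ := exists_continuous_abs_kernel_le hμ hr0 hr1
  have hc : Continuous fun y => kernel μ r x y :=
    (continuous_kernel hμ r).comp (by fun_prop : Continuous fun y : ℝ => (x, y))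
  refine (hf.norm.const_mul (B x)).mono' (hc.aestronglyMeasurable.smul hf.1)
    (Filter.Eventually.of_forall fun y => ?_)
  rw [norm_smul, Real.norm_eq_abs]
  gcongr
  exact hB x y

lemma continuous_semigroup {μ : ℝ} (hμ : -1 / 2 < μ) {t : ℝ} (ht : 0 < t)
    {f : ℝ → 𝕜} (hf : Integrable f (lam μ)) : Continuous (semigroup μ t f) := by
  have hr0 := Real.exp_pos (-t)
  have hr1 : Real.exp (-t) < 1 := Real.exp_lt_one_iff.mpr (by linarith)
  obtain ⟨B, hBc, hB⟩ := exists_continuous_abs_kernel_le hμ hr0 hr1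
  rw [continuous_iff_continuousAt]
  intro x₀
  refine continuousAt_of_dominated (bound := fun y => (B x₀ + 1) * ‖f y‖)
    (Filter.Eventually.of_forall fun x =>
      (integrable_kernel_smul hμ hr0 hr1 hf x).aestronglyMeasurable) ?_
    (hf.norm.const_mul _) (Filter.Eventually.of_forall fun y => ?_)
  · filter_upwards [hBc.continuousAt.eventually (gt_mem_nhds (lt_add_one (B x₀)))] with x hx
    refine Filter.Eventually.of_forall fun y => ?_
    rw [norm_smul, Real.norm_eq_abs]
    gcongr
    exact (hB x y).trans (le_of_lt hx)
  · have hc : Continuous fun x => kernel μ (Real.exp (-t)) x y :=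
      (continuous_kernel hμ _).comp (by fun_prop : Continuous fun x : ℝ => (x, y))
    exact (hc.smul continuous_const).continuousAt

/-- The supremum runs over uncountably many `t`, but a supremum of continuous functions is lower
semicontinuous. -/
lemma measurable_maximal {μ : ℝ} (hμ : -1 / 2 < μ) {f : ℝ → 𝕜} (hf : Integrable f (lam μ)) :
    Measurable (maximal μ f) := by
  refine LowerSemicontinuous.measurable ?_
  exact lowerSemicontinuous_biSup fun t ht =>
    (continuous_semigroup hμ ht hf).enorm.lowerSemicontinuous

/-! ### The weak type and `L^∞` bounds. -/

/-- The image of the measure `|f| dλ_μ` under the absolute value. -/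
noncomputable def foldedMeasure (μ : ℝ) (f : ℝ → 𝕜) : Measure ℝ :=
  ((lam μ).withDensity fun y => ‖f y‖ₑ).map abs

/-- The maximal function is controlled by the uncentred maximal function of the folded measure. -/
lemma exists_maximal_le {μ : ℝ} (hμ : -1 / 2 < μ) :
    ∃ C : ℝ, 0 < C ∧ ∀ f : ℝ → 𝕜, AEStronglyMeasurable f (lam μ) → ∀ (x : ℝ) (A : ℝ≥0∞), A ≠ ∞ →
      (∀ I : Set ℝ, I.OrdConnected → |x| ∈ I → foldedMeasure μ f I ≤ A * (lam μ).map abs I) →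
      maximal μ f x ≤ A * ENNReal.ofReal C := by
  obtain ⟨C, hC, h⟩ := exists_unimodal_majorant hμ
  refine ⟨C, hC, fun f hf x A hA hI => iSup₂_le fun t ht => ?_⟩
  obtain ⟨F, hFm, hF0, hFx, hK, hF⟩ := h (Real.exp (-t)) (Real.exp_pos _)
    (Real.exp_lt_one_iff.mpr (by linarith)) x
  have hFe : Measurable fun y => ENNReal.ofReal (F y) := by fun_prop
  have habs : Measurable (abs : ℝ → ℝ) := by fun_prop
  calc ‖semigroup μ t f x‖ₑ ≤ ∫⁻ y, ‖kernel μ (Real.exp (-t)) x y • f y‖ₑ ∂(lam μ) :=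
        enorm_integral_le_lintegral_enorm _
    _ ≤ ∫⁻ y, ‖f y‖ₑ * ENNReal.ofReal (F |y|) ∂(lam μ) := by
        refine lintegral_mono fun y => ?_
        rw [enorm_smul, mul_comm, Real.enorm_eq_ofReal_abs]
        gcongr
        exact hK y
    _ = ∫⁻ y, ENNReal.ofReal (F y) ∂(foldedMeasure μ f) := by
        rw [foldedMeasure, lintegral_map hFe habs,
          lintegral_withDensity_eq_lintegral_mul₀ hf.enorm
            (g := fun y => ENNReal.ofReal (F |y|)) (hFe.comp habs).aemeasurable]
        rfl
    _ ≤ A * ∫⁻ y, ENNReal.ofReal (F y) ∂((lam μ).map abs) :=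
        lintegral_le_mul_of_unimodal hA hI hFm hF0 hFx
    _ ≤ A * ENNReal.ofReal C := by
        rw [lintegral_map hFe habs]
        gcongr

lemma exists_weak_type {μ : ℝ} (hμ : -1 / 2 < μ) :
    ∃ C : ℝ, 0 < C ∧ ∀ f : ℝ → 𝕜, Integrable f (lam μ) → ∀ η : ℝ, 0 < η →
      lam μ {x : ℝ | ENNReal.ofReal η < maximal μ f x} ≤
        ENNReal.ofReal (C / η * ∫ y, ‖f y‖ ∂(lam μ)) := by
  have := isFiniteMeasure_lam hμ
  obtain ⟨C, hC, h⟩ := exists_maximal_le (𝕜 := 𝕜) hμ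
  refine ⟨2 * C, by positivity, fun f hf η hη => ?_⟩
  have habs : Measurable (abs : ℝ → ℝ) := by fun_prop
  -- Chosen so that the pointwise bound `A * C` is exactly `η`.
  set A := ENNReal.ofReal (η / C) with hA
  have hA0 : A ≠ 0 := by simpa [hA] using div_pos hη hC
  have hAtop : A ≠ ∞ := ENNReal.ofReal_ne_top
  set E := {x | ∃ I : Set ℝ, I.OrdConnected ∧ x ∈ I ∧
    A * (lam μ).map abs I < foldedMeasure μ f I} with hE
  have hsub : {x : ℝ | ENNReal.ofReal η < maximal μ f x} ⊆ abs ⁻¹' E := by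
    intro x hx
    by_contra hxE
    refine not_le.mpr hx ((h f hf.1 x A hAtop fun I hI hxI => ?_).trans_eq ?_)
    · by_contra hlt
      exact hxE ⟨I, hI, hxI, not_le.mp hlt⟩
    · rw [hA, ← ENNReal.ofReal_mul (by positivity), div_mul_cancel₀ _ hC.ne']
  have hmass : foldedMeasure μ f Set.univ = ENNReal.ofReal (∫ y, ‖f y‖ ∂(lam μ)) := by
    rw [foldedMeasure, Measure.map_apply habs MeasurableSet.univ, Set.preimage_univ,
      withDensity_apply _ MeasurableSet.univ, Measure.restrict_univ,
      ofReal_integral_norm_eq_lintegral_enorm hf]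
  have hw := mul_measure_exists_ordConnected_le ((lam μ).map abs) (foldedMeasure μ f) A hAtop
  rw [← hE, hmass] at hw
  calc lam μ {x : ℝ | ENNReal.ofReal η < maximal μ f x} ≤ lam μ (abs ⁻¹' E) := measure_mono hsub
    -- This inequality needs no measurability of `E`.
    _ ≤ (lam μ).map abs E := Measure.le_map_apply habs.aemeasurable E
    _ ≤ 2 * ENNReal.ofReal (∫ y, ‖f y‖ ∂(lam μ)) / A := by
        rw [ENNReal.le_div_iff_mul_le (Or.inl hA0) (Or.inl hAtop), mul_comm]
        exact hw
    _ = ENNReal.ofReal (2 * C / η * ∫ y, ‖f y‖ ∂(lam μ)) := by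
        rw [hA, ← ENNReal.ofReal_ofNat, ← ENNReal.ofReal_mul zero_le_two,
          ← ENNReal.ofReal_div_of_pos (by positivity)]
        congr 1
        field_simp

lemma exists_eLpNorm_top_maximal_le {μ : ℝ} (hμ : -1 / 2 < μ) :
    ∃ C : ℝ, 0 < C ∧ ∀ f : ℝ → 𝕜, MemLp f ∞ (lam μ) →
      eLpNorm (maximal μ f) ∞ (lam μ) ≤ ENNReal.ofReal C * eLpNorm f ∞ (lam μ) := by
  obtain ⟨C, hC, h⟩ := exists_maximal_le (𝕜 := 𝕜) hμ
  refine ⟨C, hC, fun f hf => ?_⟩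
  have habs : Measurable (abs : ℝ → ℝ) := by fun_prop
  -- Thus `A = ‖f‖_∞` is admissible at every `x`.
  have hle : foldedMeasure μ f ≤ eLpNorm f ∞ (lam μ) • (lam μ).map abs := by
    rw [← Measure.map_smul, foldedMeasure]
    refine Measure.map_mono ?_ habs
    rw [← withDensity_const]
    refine withDensity_mono ?_
    rw [eLpNorm_exponent_top]
    exact ae_le_eLpNormEssSup
  have hx : ∀ x, maximal μ f x ≤ ENNReal.ofReal C * eLpNorm f ∞ (lam μ) := fun x => by
    rw [mul_comm]
    exact h f hf.1 x _ hf.2.ne fun I _ _ => by simpa using hle I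
  rw [eLpNorm_exponent_top]
  exact essSup_le_of_ae_le _ (Filter.Eventually.of_forall hx)

end

end GenOU

theorem theorem2p1 {𝕜 : Type*} [RCLike 𝕜] (μ : ℝ) (hμ : -1 / 2 < μ) :
    -- the integrals defining `T_μ^t f(x)` converge absolutely and `T_μ^* f` is measurable
    (∀ f : ℝ → 𝕜, Integrable f (GenOU.lam μ) →
      (∀ t : ℝ, 0 < t → ∀ x : ℝ,
        Integrable (fun y => GenOU.kernel μ (Real.exp (-t)) x y • f y) (GenOU.lam μ)) ∧
      Measurable (GenOU.maximal μ f)) ∧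
    -- weak type (1,1)
    (∃ C : ℝ, 0 < C ∧ ∀ f : ℝ → 𝕜, Integrable f (GenOU.lam μ) → ∀ η : ℝ, 0 < η →
      GenOU.lam μ {x : ℝ | ENNReal.ofReal η < GenOU.maximal μ f x} ≤
        ENNReal.ofReal (C / η * ∫ y, ‖f y‖ ∂(GenOU.lam μ))) ∧
    -- boundedness on `L^∞`; as `λ_μ` is finite, `L^∞ ⊆ L¹` and the first part applies here too
    (∃ C : ℝ, 0 < C ∧ ∀ f : ℝ → 𝕜, MemLp f ∞ (GenOU.lam μ) →
      eLpNorm (GenOU.maximal μ f) ∞ (GenOU.lam μ) ≤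
        ENNReal.ofReal C * eLpNorm f ∞ (GenOU.lam μ)) := by
  exact ⟨fun f hf => ⟨fun t ht x => GenOU.integrable_kernel_smul hμ (Real.exp_pos _)
      (Real.exp_lt_one_iff.mpr (by linarith)) hf x, GenOU.measurable_maximal hμ hf⟩,
    GenOU.exists_weak_type hμ, GenOU.exists_eLpNorm_top_maximal_le hμ⟩
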